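/- For $n\ge 1$ let $\mathrm{Sp}(2n,\mathbb{F}_2)$ be the group of $2n\times 2n$ matrices $M$ over $\mathbb{F}_2$ with $M^T\Omega M=\Omega$, where $\Omega=\begin{bmatrix}0&I_n\\I_n&0\end{bmatrix}$. Label the columns $x_1,\dots,x_n,z_1,\dots,z_n$. Let $H_i$ be the identity matrix $I_{2n}$ with columns $x_i$ and $z_i$ swapped, let $S_i$ be $I_{2n}$ with column $x_i$ added to column $z_i$, and for $i<j$ let $\mathrm{CZ}_{i,j}$ be $I_{2n}$ with column $x_j$ added to column $z_i$ and column $x_i$ added to column $z_j$. Put $$\mathcal{G}=\{H_i:1\le i\le n\}\cup\{S_i:1\le i\le n\}\cup\{\mathrm{CZ}_{i,j}:1\le i<j\le n\}\subseteq \Gamma:=\mathrm{Sp}(2n,\mathbb{F}_2),$$ and let $K(M,N)=|\{G\in\mathcal{G}: MG=N\}|/|\mathcal{G}|$, $M,N\in\Gamma$, be the transition matrix of the random walk on $\Gamma$ that right-multiplies by a uniformly sampled element of $\mathcal{G}$. 1. If $n\ge 3$, then the $d$-step distribution from the identity converges to the uniform distribution on $\Gamma$: $$K^d(I_{2n},M)\longrightarrow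 \frac{1}{|\Gamma|}\quad (d\to\infty)\qquad\text{for every } M\in\Gamma.$$ 2. If $n=1$ or $n=2$, then the walk has period $2$, that is, $\gcd\{k\ge 1: K^k(M,M)>0\}=2$ for every $M\in\Gamma$. The $d$-step distributions $K^d(I_{2n},\cdot)$ do not converge to the uniform distribution on $\Gamma$ as $d\to\infty$; in fact they do not converge to any limit: there is no function $\mu:\Gamma\to\mathbb{R}$ with $K^d(I_{2n},M)\to\mu(M)$ for every $M\in\Gamma$. -/

import Mathlib

open Filter Topology

namespace CliffordWalk

/-- The matrix `Ω = [[0, I], [I, 0]]` over `𝔽₂`. Indices `Sum.inl k` are the `X`-coordinates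
(the first `n` rows and columns), indices `Sum.inr k` the `Z`-coordinates (the last `n`). -/
def Omega (n : ℕ) : Matrix (Fin n ⊕ Fin n) (Fin n ⊕ Fin n) (ZMod 2) :=
  Matrix.fromBlocks 0 1 1 0

/-- `Sp(2n, 𝔽₂)`, Mathlib's symplectic group; `mem_Sp_iff` below identifies it with the matrices
satisfying `Mᵀ Ω M = Ω`. -/
abbrev Sp (n : ℕ) : Type :=
  ↥(Matrix.symplecticGroup (Fin n) (ZMod 2))

theorem J_eq_Omega (n : ℕ) : Matrix.J (Fin n) (ZMod 2) = Omega n := by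
  ext a b
  rcases a with a | a <;> rcases b with b | b <;>
    simp [Matrix.J, Omega, ZMod.neg_eq_self_mod_two]

theorem mem_Sp_iff {n : ℕ} (M : Matrix (Fin n ⊕ Fin n) (Fin n ⊕ Fin n) (ZMod 2)) :
    M ∈ Matrix.symplecticGroup (Fin n) (ZMod 2) ↔ M.transpose * Omega n * M = Omega n := by
  rw [SymplecticGroup.mem_iff', J_eq_Omega]

instance decidableMemSp (n : ℕ) :
    DecidablePred (fun M => M ∈ Matrix.symplecticGroup (Fin n) (ZMod 2)) :=
  fun M => decidable_of_iff (M.transpose * Omega n * M = Omega n) (mem_Sp_iff M).symm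

instance fintypeSp (n : ℕ) : Fintype (Sp n) :=
  Subtype.fintype (fun M => M ∈ Matrix.symplecticGroup (Fin n) (ZMod 2))

/-- The tableau of the Hadamard gate on qubit `i`: the identity matrix with the columns `x_i` and
`z_i` swapped. -/
def matH {n : ℕ} (i : Fin n) : Matrix (Fin n ⊕ Fin n) (Fin n ⊕ Fin n) (ZMod 2) :=
  (1 : Matrix (Fin n ⊕ Fin n) (Fin n ⊕ Fin n) (ZMod 2)).submatrix id
    (Equiv.swap (Sum.inl i) (Sum.inr i))

/-- The tableau of the phase gate on qubit `i`: the identity matrix with column `x_i` added to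
column `z_i`. -/
def matS {n : ℕ} (i : Fin n) : Matrix (Fin n ⊕ Fin n) (Fin n ⊕ Fin n) (ZMod 2) :=
  1 + Matrix.single (Sum.inl i) (Sum.inr i) 1

/-- The tableau of the controlled-`Z` gate on qubits `i` and `j` (used for `i < j`): the identity
matrix with column `x_j` added to column `z_i` and column `x_i` added to column `z_j`. -/
def matCZ {n : ℕ} (i j : Fin n) : Matrix (Fin n ⊕ Fin n) (Fin n ⊕ Fin n) (ZMod 2) :=
  1 + Matrix.single (Sum.inl j) (Sum.inr i) 1 + Matrix.single (Sum.inl i) (Sum.inr j) 1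

theorem add_self_eq_zero_mod_two {n : ℕ} (A : Matrix (Fin n) (Fin n) (ZMod 2)) : A + A = 0 := by
  ext a b
  exact CharTwo.add_self_eq_zero (A a b)

theorem matH_mem {n : ℕ} (i : Fin n) :
    matH i ∈ Matrix.symplecticGroup (Fin n) (ZMod 2) := by
  rw [mem_Sp_iff]
  have h : matH i = Matrix.fromBlocks (1 - Matrix.single i i 1) (Matrix.single i i 1)
      (Matrix.single i i 1) (1 - Matrix.single i i 1) := by
    ext a b
    rcases a with a | a <;> rcases b with b | b <;>
      by_cases ha : i = a <;> by_cases hb : i = b <;>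
      simp [matH, Matrix.one_apply, Matrix.single_apply, Equiv.swap_apply_def, ha, hb, eq_comm] <;>
      simp_all [eq_comm]
  rw [h, Omega, Matrix.fromBlocks_transpose]
  simp [Matrix.fromBlocks_multiply, mul_sub, sub_mul]

theorem matS_mem {n : ℕ} (i : Fin n) :
    matS i ∈ Matrix.symplecticGroup (Fin n) (ZMod 2) := by
  rw [mem_Sp_iff]
  have h : matS i = Matrix.fromBlocks 1 (Matrix.single i i 1) 0 1 := by
    ext a b
    rcases a with a | a <;> rcases b with b | b <;>
      simp [matS, Matrix.one_apply, Matrix.single_apply]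
  rw [h, Omega, Matrix.fromBlocks_transpose]
  simp [Matrix.fromBlocks_multiply, add_self_eq_zero_mod_two]

theorem matCZ_mem {n : ℕ} (i j : Fin n) :
    matCZ i j ∈ Matrix.symplecticGroup (Fin n) (ZMod 2) := by
  rw [mem_Sp_iff]
  have h : matCZ i j =
      Matrix.fromBlocks 1 (Matrix.single j i 1 + Matrix.single i j 1) 0 1 := by
    ext a b
    rcases a with a | a <;> rcases b with b | b <;>
      simp [matCZ, Matrix.one_apply, Matrix.single_apply]
  rw [h, Omega, Matrix.fromBlocks_transpose]
  simp [Matrix.fromBlocks_multiply, add_comm (Matrix.single i j (1 : ZMod 2)),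
    add_self_eq_zero_mod_two]

/-- The generator `H_i` of `Sp(2n, 𝔽₂)`. -/
def gateH {n : ℕ} (i : Fin n) : Sp n := ⟨matH i, matH_mem i⟩

/-- The generator `S_i` of `Sp(2n, 𝔽₂)`. -/
def gateS {n : ℕ} (i : Fin n) : Sp n := ⟨matS i, matS_mem i⟩

/-- The generator `CZ_{i,j}` of `Sp(2n, 𝔽₂)`. -/
def gateCZ {n : ℕ} (i j : Fin n) : Sp n := ⟨matCZ i j, matCZ_mem i j⟩

/-- The generating set `{H_i} ∪ {S_i} ∪ {CZ_{i,j} : i < j}`. -/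
def generators (n : ℕ) : Finset (Sp n) :=
  Finset.univ.image gateH ∪ Finset.univ.image gateS ∪
    (Finset.univ.filter (fun p : Fin n × Fin n => p.1 < p.2)).image (fun p => gateCZ p.1 p.2)

/-- The transition matrix of the random walk on `Sp(2n, 𝔽₂)` that right-multiplies by a uniformly
sampled generator: the entry at `(M, N)` is the probability that `M * G = N` when `G` is uniform
on `generators n`. -/
noncomputable def transition (n : ℕ) : Matrix (Sp n) (Sp n) ℝ :=
  Matrix.of fun M N =>
    (((generators n).filter (fun G => M * G = N)).card : ℝ) / ((generators n).card : ℝ)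

/-- `p` is the period of the state `x` of the finite Markov chain with transition matrix `P`: the
greatest common divisor of all `k ≥ 1` with `(P ^ k) x x > 0`, expressed by its defining property
that its divisors are exactly the common divisors of these `k`. -/
def HasPeriod {α : Type*} [Fintype α] [DecidableEq α] (P : Matrix α α ℝ) (x : α) (p : ℕ) : Prop :=
  ∀ m : ℕ, m ∣ p ↔ ∀ k : ℕ, 1 ≤ k → 0 < (P ^ k) x x → m ∣ k

end CliffordWalk

/-! The walk converges exactly when the gates generate the group and some word of odd length in them
equals the identity. Generation holds for every `n`. `H_i` and `S_i` are transvections and `CZ` is a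
product of three commuting ones, so conjugation puts every transvection in the gate group
(`transvection_mem`); products of transvections then carry the images of the hyperbolic pairs back
to the standard ones, one qubit at a time (`gateGroup_eq_top`). All gates are involutions, so even
padding is free. For `n ≥ 3` the commutator relation of CNOT gates on three qubits is a relation of
length 15 (`cnot_commutator`). Hence some power of the doubly stochastic transition matrix is
entrywise positive, and a contraction argument gives convergence. For `n = 1, 2` the sign of the
action on even quadratic forms is a homomorphism to `±1` equal to `-1` on every gate. It forces the
walk to alternate between two cosets. -/

namespace CliffordWalk

open Matrix

/-! ### Symplectic form and transvections -/

/-- The standard symplectic form on `𝔽₂²ⁿ`. -/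
def form {n : ℕ} (v w : Fin n ⊕ Fin n → ZMod 2) : ZMod 2 := v ⬝ᵥ (Omega n *ᵥ w)

theorem form_eq_sum {n : ℕ} (v w : Fin n ⊕ Fin n → ZMod 2) :
    form v w = ∑ k, (v (Sum.inl k) * w (Sum.inr k) + v (Sum.inr k) * w (Sum.inl k)) := by
  have h : Omega n *ᵥ w = Sum.elim (w ∘ Sum.inr) (w ∘ Sum.inl) := by
    simp [Omega, fromBlocks_mulVec]
  simp [form, h, dotProduct, Finset.sum_add_distrib]

theorem form_comm {n : ℕ} (v w : Fin n ⊕ Fin n → ZMod 2) : form v w = form w v := by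
  simp only [form_eq_sum]
  exact Finset.sum_congr rfl fun k _ => by ring

theorem form_self {n : ℕ} (v : Fin n ⊕ Fin n → ZMod 2) : form v v = 0 := by
  rw [form_eq_sum]
  refine Finset.sum_eq_zero fun k _ => ?_
  rw [mul_comm]
  exact CharTwo.add_self_eq_zero _

theorem form_add_left {n : ℕ} (u v w : Fin n ⊕ Fin n → ZMod 2) :
    form (u + v) w = form u w + form v w := add_dotProduct _ _ _

theorem form_add_right {n : ℕ} (u v w : Fin n ⊕ Fin n → ZMod 2) :
    form u (v + w) = form u v + form u w := by
  simp [form, mulVec_add, dotProduct_add]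

theorem form_smul_left {n : ℕ} (c : ZMod 2) (v w : Fin n ⊕ Fin n → ZMod 2) :
    form (c • v) w = c * form v w := smul_dotProduct _ _ _

theorem form_smul_right {n : ℕ} (c : ZMod 2) (v w : Fin n ⊕ Fin n → ZMod 2) :
    form v (c • w) = c * form v w := by
  simp [form, mulVec_smul, dotProduct_smul]

theorem form_single_right {n : ℕ} (v : Fin n ⊕ Fin n → ZMod 2) (a : Fin n ⊕ Fin n) :
    form v (Pi.single a 1) = v a.swap := by
  rcases a with a | a <;> simp [form_eq_sum, Pi.single_apply]

theorem form_mulVec {n : ℕ} {M : Matrix (Fin n ⊕ Fin n) (Fin n ⊕ Fin n) (ZMod 2)}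
    (hM : M ∈ symplecticGroup (Fin n) (ZMod 2)) (v w : Fin n ⊕ Fin n → ZMod 2) :
    form (M *ᵥ v) (M *ᵥ w) = form v w := by
  rw [mem_Sp_iff] at hM
  unfold form
  conv_rhs => rw [← hM]
  rw [← mulVec_mulVec, ← mulVec_mulVec, dotProduct_mulVec v, vecMul_transpose]

theorem mem_symplecticGroup_of_form {n : ℕ}
    {M : Matrix (Fin n ⊕ Fin n) (Fin n ⊕ Fin n) (ZMod 2)}
    (h : ∀ v w, form (M *ᵥ v) (M *ᵥ w) = form v w) :
    M ∈ symplecticGroup (Fin n) (ZMod 2) := by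
  rw [mem_Sp_iff]
  ext a b
  have := h (Pi.single a 1) (Pi.single b 1)
  unfold form at this
  rw [mulVec_mulVec, ← vecMul_transpose, ← dotProduct_mulVec, mulVec_mulVec, ← mul_assoc] at this
  simpa using this

theorem transvection_mulVec {n : ℕ} (v w : Fin n ⊕ Fin n → ZMod 2) :
    (1 + vecMulVec v (Omega n *ᵥ v)) *ᵥ w = w + form w v • v := by
  rw [add_mulVec, one_mulVec, vecMulVec_mulVec, form, dotProduct_comm]
  simp

/-- The symplectic transvection `w ↦ w + ω(w, v) v`. -/
def transvection {n : ℕ} (v : Fin n ⊕ Fin n → ZMod 2) : Sp n :=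
  ⟨1 + vecMulVec v (Omega n *ᵥ v), mem_symplecticGroup_of_form fun a b => by
    simp only [transvection_mulVec, form_add_left, form_add_right, form_smul_left,
      form_smul_right, form_self, form_comm v b]
    linear_combination CharTwo.add_self_eq_zero (form a v * form b v)⟩

theorem transvection_apply {n : ℕ} (v w : Fin n ⊕ Fin n → ZMod 2) :
    (transvection v).1 *ᵥ w = w + form w v • v := transvection_mulVec v w

theorem Sp_ext {n : ℕ} {M N : Sp n} (h : ∀ w, M.1 *ᵥ w = N.1 *ᵥ w) : M = N :=
  Subtype.ext (Matrix.ext_of_mulVec_single fun _ => h _)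

theorem mul_apply {n : ℕ} (M N : Sp n) (w : Fin n ⊕ Fin n → ZMod 2) :
    (M * N).1 *ᵥ w = M.1 *ᵥ (N.1 *ᵥ w) := (mulVec_mulVec _ _ _).symm

theorem eq_zero_or_eq_one (a : ZMod 2) : a = 0 ∨ a = 1 := by
  revert a; decide

theorem vec_add_self {n : ℕ} (v : Fin n ⊕ Fin n → ZMod 2) : v + v = 0 :=
  funext fun a => CharTwo.add_self_eq_zero (v a)

theorem transvection_mul_self {n : ℕ} (v : Fin n ⊕ Fin n → ZMod 2) :
    transvection v * transvection v = 1 := by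
  refine Sp_ext fun w => ?_
  simp only [mul_apply, transvection_apply, form_add_left, form_smul_left, form_self, mul_zero,
    add_zero, add_assoc, ← smul_add, vec_add_self]
  simp

/-- An instance of `g T_v g⁻¹ = T_{gv}`: here `T_u` is an involution and sends `v` to `u + v`. -/
theorem transvection_conj {n : ℕ} (u v : Fin n ⊕ Fin n → ZMod 2) (h : form u v = 1) :
    transvection u * transvection v * transvection u = transvection (u + v) := by
  refine Sp_ext fun w => ?_
  simp only [mul_apply, transvection_apply, form_add_left, form_add_right, form_smul_left,
    form_self, form_comm v u, h, smul_add, add_smul]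
  have key : ∀ x y z p q : ZMod 2,
      x + p * y + (q * z + p * 1 * z) + (p * y + p * 0 * y + (q * 1 * y + p * 1 * 1 * y)) =
        x + (p * y + q * y + (p * z + q * z)) := by decide
  exact funext fun a => key _ _ _ _ _

/-! ### Gates in terms of transvections -/

theorem gateH_apply {n : ℕ} (i : Fin n) (w : Fin n ⊕ Fin n → ZMod 2) :
    (gateH i).1 *ᵥ w = w ∘ Equiv.swap (Sum.inl i) (Sum.inr i) := by
  simp only [gateH, matH, submatrix_mulVec_equiv, one_mulVec, Equiv.symm_swap, Function.comp_id]

theorem gateS_apply {n : ℕ} (i : Fin n) (w : Fin n ⊕ Fin n → ZMod 2) :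
    (gateS i).1 *ᵥ w = w + Pi.single (Sum.inl i) (w (Sum.inr i)) := by
  simp only [gateS, matS, add_mulVec, one_mulVec, single_mulVec, one_mul]
  rfl

theorem gateCZ_apply {n : ℕ} (i j : Fin n) (w : Fin n ⊕ Fin n → ZMod 2) :
    (gateCZ i j).1 *ᵥ w = w + Pi.single (Sum.inl j) (w (Sum.inr i)) +
      Pi.single (Sum.inl i) (w (Sum.inr j)) := by
  simp only [gateCZ, matCZ, add_mulVec, one_mulVec, single_mulVec, one_mul]
  rfl

theorem transvection_zero {n : ℕ} : transvection (0 : Fin n ⊕ Fin n → ZMod 2) = 1 :=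
  Sp_ext fun w => by simp [transvection_apply]

theorem gateS_eq {n : ℕ} (i : Fin n) : gateS i = transvection (Pi.single (Sum.inl i) 1) := by
  refine Sp_ext fun w => ?_
  rw [gateS_apply, transvection_apply, form_single_right, ← Pi.single_smul]
  simp

theorem gateH_eq {n : ℕ} (i : Fin n) :
    gateH i = transvection (Pi.single (Sum.inl i) 1 + Pi.single (Sum.inr i) 1) := by
  refine Sp_ext fun w => ?_
  rw [gateH_apply, transvection_apply, form_add_right, form_single_right, form_single_right]
  ext a
  have h2 : ∀ x y : ZMod 2, x = y + (x + y) ∧ x = y + (y + x) := by decide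
  rcases a with a | a <;> by_cases h : a = i
  · subst h; simpa using (h2 _ _).1
  · simp [h, Equiv.swap_apply_def]
  · subst h; simpa using (h2 _ _).2
  · simp [h, Equiv.swap_apply_def]

/-- With `p`, `q` the `z_i`, `z_j` coordinates of `w`, the orthogonal directions `x_i`, `x_j` give
`p x_i + q x_j + (p + q)(x_i + x_j) = q x_i + p x_j`. -/
theorem gateCZ_eq {n : ℕ} (i j : Fin n) :
    gateCZ i j = transvection (Pi.single (Sum.inl i) 1) * transvection (Pi.single (Sum.inl j) 1) *
      transvection (Pi.single (Sum.inl i) 1 + Pi.single (Sum.inl j) 1) := by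
  refine Sp_ext fun w => ?_
  simp only [mul_apply, gateCZ_apply, transvection_apply, form_add_right,
    form_single_right]
  ext a
  simp only [Pi.add_apply, Pi.smul_apply, smul_eq_mul, Sum.swap_inl, Pi.single_apply, reduceCtorEq,
    if_false]
  generalize w (Sum.inr i) = p
  generalize w (Sum.inr j) = q
  generalize w a = x
  split_ifs <;> revert x p q <;> decide

/-! ### All transvections lie in the gate group -/

/-- The subgroup generated by the gates. -/
def gateGroup (n : ℕ) : Subgroup (Sp n) := Subgroup.closure (generators n : Set (Sp n))

theorem gateH_mem {n : ℕ} (i : Fin n) : gateH i ∈ generators n := by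
  simp [generators]

theorem gateS_mem {n : ℕ} (i : Fin n) : gateS i ∈ generators n := by
  simp [generators]

theorem gateCZ_comm {n : ℕ} (i j : Fin n) : gateCZ i j = gateCZ j i := by
  refine Sp_ext fun w => ?_
  rw [gateCZ_apply, gateCZ_apply, add_right_comm]

theorem gateCZ_mem {n : ℕ} {i j : Fin n} (h : i ≠ j) : gateCZ i j ∈ generators n := by
  rcases lt_or_gt_of_ne h with h | h
  · simp only [generators, Finset.mem_union, Finset.mem_image, Finset.mem_filter]
    exact Or.inr ⟨(i, j), by simpa using h, rfl⟩
  · rw [gateCZ_comm]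
    simp only [generators, Finset.mem_union, Finset.mem_image, Finset.mem_filter]
    exact Or.inr ⟨(j, i), by simpa using h, rfl⟩

theorem transvection_add_mem {n : ℕ} {T : Subgroup (Sp n)} {u v : Fin n ⊕ Fin n → ZMod 2}
    (hu : transvection u ∈ T) (hv : transvection v ∈ T) (h : form u v = 1) :
    transvection (u + v) ∈ T := by
  rw [← transvection_conj u v h]
  exact T.mul_mem (T.mul_mem hu hv) hu

/-- The vector `u` bridges the orthogonal pair `v`, `w`: adding `u + w` to `v` and then `u` are both
sums of vectors pairing to 1. -/
theorem transvection_add_mem_of_orthogonal {n : ℕ} {T : Subgroup (Sp n)}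
    {u v w : Fin n ⊕ Fin n → ZMod 2} (hv : transvection v ∈ T) (hu : transvection u ∈ T)
    (huw : transvection (u + w) ∈ T) (h : form v u = 1) (h1 : form v w = 0) (h2 : form u w = 0) :
    transvection (v + w) ∈ T := by
  have h3 : transvection (v + (u + w)) ∈ T :=
    transvection_add_mem hv huw (by rw [form_add_right, h, h1, add_zero])
  have h4 : transvection (v + (u + w) + u) ∈ T := transvection_add_mem h3 hu (by
    rw [form_add_left, form_add_left, form_self, h, form_comm w u, h2, add_zero, add_zero])
  have h5 : v + (u + w) + u = v + w := by
    rw [show v + (u + w) + u = v + w + (u + u) by abel, vec_add_self, add_zero]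
  rwa [h5] at h4

theorem transvection_single_mem {n : ℕ} (a : Fin n ⊕ Fin n) :
    transvection (Pi.single a 1) ∈ gateGroup n := by
  rcases a with i | i
  · rw [← gateS_eq]
    exact Subgroup.subset_closure (gateS_mem i)
  · have h : (Pi.single (Sum.inr i) 1 : Fin n ⊕ Fin n → ZMod 2) =
        Pi.single (Sum.inl i) 1 + (Pi.single (Sum.inl i) 1 + Pi.single (Sum.inr i) 1) := by
      rw [← add_assoc, vec_add_self, zero_add]
    rw [h]
    refine transvection_add_mem ?_ ?_ ?_
    · rw [← gateS_eq]
      exact Subgroup.subset_closure (gateS_mem i)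
    · rw [← gateH_eq]
      exact Subgroup.subset_closure (gateH_mem i)
    · rw [form_add_right, form_self, form_single_right]
      simp

theorem transvection_single_add_inl_mem {n : ℕ} {k l : Fin n} (h : k ≠ l) :
    transvection (Pi.single (Sum.inl k) 1 + Pi.single (Sum.inl l) 1) ∈ gateGroup n := by
  have hk := transvection_single_mem (Sum.inl k)
  have hl := transvection_single_mem (Sum.inl l)
  have hc : gateCZ k l ∈ gateGroup n := Subgroup.subset_closure (gateCZ_mem h)
  rw [gateCZ_eq] at hc
  exact (Subgroup.mul_mem_cancel_left _ (Subgroup.mul_mem _ hk hl)).1 hc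

/-- Replaces `x_l` by `z_l` along the chain `v + x_l`, `v + x_l + z_l`, `v + z_l`. -/
theorem transvection_add_inr_mem {n : ℕ} {l : Fin n} {v : Fin n ⊕ Fin n → ZMod 2}
    (hv : form v (Pi.single (Sum.inl l) 1) = 0)
    (hm : transvection (v + Pi.single (Sum.inl l) 1) ∈ gateGroup n)
    (hv' : form v (Pi.single (Sum.inr l) 1) = 0) :
    transvection (v + Pi.single (Sum.inr l) 1) ∈ gateGroup n := by
  have h1 := transvection_add_mem hm (transvection_single_mem (Sum.inr l)) (by
    rw [form_add_left, hv', form_single_right]; simp)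
  have h2 := transvection_add_mem h1 (transvection_single_mem (Sum.inl l)) (by
    rw [form_add_left, form_add_left, hv, form_self, form_single_right]; simp)
  rwa [show v + Pi.single (Sum.inl l) 1 + Pi.single (Sum.inr l) 1 + Pi.single (Sum.inl l) 1 =
    v + Pi.single (Sum.inr l) 1 + (Pi.single (Sum.inl l) 1 + Pi.single (Sum.inl l) 1) by abel,
    vec_add_self, add_zero] at h2

theorem transvection_single_add_single_mem {n : ℕ} {a b : Fin n ⊕ Fin n} (h : a ≠ b)
    (h' : a ≠ b.swap) :
    transvection (Pi.single a 1 + Pi.single b 1) ∈ gateGroup n := by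
  have key : ∀ (a : Fin n ⊕ Fin n) (l : Fin n), a ≠ Sum.inl l → a ≠ Sum.inr l →
      transvection (Pi.single a 1 + Pi.single (Sum.inl l) 1) ∈ gateGroup n →
      transvection (Pi.single a 1 + Pi.single (Sum.inr l) 1) ∈ gateGroup n := by
    intro a l h1 h2 hm
    refine transvection_add_inr_mem ?_ hm ?_ <;> rw [form_single_right]
    · exact Pi.single_eq_of_ne h2.symm _
    · exact Pi.single_eq_of_ne h1.symm _
  rcases a with k | k <;> rcases b with l | l
  · exact transvection_single_add_inl_mem (by simpa using h)
  · exact key _ _ (by simpa using h') (by simp)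
      (transvection_single_add_inl_mem (by simpa using h'))
  · rw [add_comm]
    have hlk : l ≠ k := by simpa [eq_comm] using h'
    exact key _ _ (by simpa using hlk) (by simp) (transvection_single_add_inl_mem hlk)
  · have hkl : k ≠ l := by simpa using h
    refine key _ _ (by simp) (by simpa using hkl) ?_
    rw [add_comm]
    exact key _ _ (by simpa using hkl.symm) (by simp) (transvection_single_add_inl_mem hkl.symm)

theorem exists_form_single_eq_one {n : ℕ} {v : Fin n ⊕ Fin n → ZMod 2} (hv : v ≠ 0) :
    ∃ b, form v (Pi.single b 1) = 1 := by
  obtain ⟨a, ha⟩ := Function.ne_iff.1 hv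
  refine ⟨a.swap, ?_⟩
  rw [form_single_right, Sum.swap_swap]
  exact (eq_zero_or_eq_one (v a)).resolve_left ha

/-- Induction on a set containing the support, splitting off one basis vector `e_a`. -/
theorem transvection_mem {n : ℕ} (v : Fin n ⊕ Fin n → ZMod 2) : transvection v ∈ gateGroup n := by
  suffices H : ∀ s : Finset (Fin n ⊕ Fin n), ∀ v : Fin n ⊕ Fin n → ZMod 2,
      (∀ a, a ∉ s → v a = 0) → transvection v ∈ gateGroup n from H Finset.univ v (by simp)
  intro s
  induction s using Finset.induction_on with
  | empty =>
    intro v hv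
    rw [show v = 0 from funext fun a => hv a (by simp), transvection_zero]
    exact Subgroup.one_mem _
  | insert a s has ih =>
    intro v hv
    rcases eq_zero_or_eq_one (v a) with h0 | h1
    · refine ih v fun b hb => ?_
      by_cases hba : b = a
      · rw [hba, h0]
      · exact hv b (by simp [hb, hba])
    · obtain ⟨u, hu⟩ : ∃ u, u = v + Pi.single a 1 := ⟨_, rfl⟩
      have hua : u a = 0 := by
        rw [hu, Pi.add_apply, h1, Pi.single_eq_same]
        rfl
      have hum : transvection u ∈ gateGroup n := by
        refine ih u fun b hb => ?_
        by_cases hba : b = a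
        · rw [hba, hua]
        · simp [hu, hba, hv b (by simp [hb, hba])]
      have hvu : v = u + Pi.single a 1 := by rw [hu, add_assoc, vec_add_self, add_zero]
      rw [hvu]
      by_cases hu0 : u = 0
      · rw [hu0, zero_add]
        exact transvection_single_mem a
      rcases eq_zero_or_eq_one (form u (Pi.single a 1)) with hf | hf
      -- The rest `u` is orthogonal to `e_a`, so a basis vector `e_b` pairing with `u` serves as
      -- bridge; `u a = 0` excludes the partner of `a`.
      · obtain ⟨b, hb⟩ := exists_form_single_eq_one hu0
        have hba : b ≠ a := by
          rintro rfl
          simp [hf] at hb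
        have hba' : b ≠ a.swap := by
          rintro rfl
          rw [form_single_right, Sum.swap_swap, hua] at hb
          simp at hb
        refine transvection_add_mem_of_orthogonal hum (transvection_single_mem b)
          (transvection_single_add_single_mem hba hba') hb hf ?_
        rw [form_single_right, Pi.single_eq_of_ne hba'.symm]
      · exact transvection_add_mem hum (transvection_single_mem a) hf

/-! ### Generation of the symplectic group -/

/-- The transvection along `u + v` does this; it fixes everything orthogonal to `u + v`. -/
theorem exists_mem_gateGroup_of_form_eq_one {n : ℕ} {u v : Fin n ⊕ Fin n → ZMod 2}
    (h : form u v = 1) :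
    ∃ g ∈ gateGroup n, g.1 *ᵥ u = v ∧ ∀ a, form a u = form a v → g.1 *ᵥ a = a := by
  refine ⟨transvection (u + v), transvection_mem _, ?_, fun a ha => ?_⟩
  · rw [transvection_apply, form_add_right, form_self, h, zero_add, one_smul, ← add_assoc,
      vec_add_self, zero_add]
  · rw [transvection_apply, form_add_right, ha, CharTwo.add_self_eq_zero, zero_smul, add_zero]

theorem exists_mem_gateGroup_of_form_eq_one₂ {n : ℕ} {u w v : Fin n ⊕ Fin n → ZMod 2}
    (h : form u w = 1) (h' : form w v = 1) :
    ∃ g ∈ gateGroup n, g.1 *ᵥ u = v ∧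
      ∀ a, form a u = form a w → form a w = form a v → g.1 *ᵥ a = a := by
  obtain ⟨g, hg, hgu, hga⟩ := exists_mem_gateGroup_of_form_eq_one h
  obtain ⟨k, hk, hkw, hka⟩ := exists_mem_gateGroup_of_form_eq_one h'
  refine ⟨k * g, mul_mem hk hg, ?_, fun a ha ha' => ?_⟩
  · rw [mul_apply, hgu, hkw]
  · rw [mul_apply, hga a ha, hka a ha']

/-- Adjusting the image of a hyperbolic pair by an element of the gate group. -/
theorem exists_mem_gateGroup_fix_inl {n : ℕ} (M : Sp n) (j : Fin n) :
    ∃ g ∈ gateGroup n, (g * M).1 *ᵥ Pi.single (Sum.inl j) 1 = Pi.single (Sum.inl j) 1 ∧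
      ∀ c : Fin n ⊕ Fin n, c ≠ Sum.inl j → c ≠ Sum.inr j →
        M.1 *ᵥ Pi.single c 1 = Pi.single c 1 →
        M.1 *ᵥ Pi.single c.swap 1 = Pi.single c.swap 1 →
        (g * M).1 *ᵥ Pi.single c 1 = Pi.single c 1 := by
  obtain ⟨u, hu⟩ : ∃ u, u = M.1 *ᵥ Pi.single (Sum.inl j) 1 := ⟨_, rfl⟩
  have hfix : ∀ c : Fin n ⊕ Fin n, c ≠ Sum.inr j → M.1 *ᵥ Pi.single c 1 = Pi.single c 1 →
      form u (Pi.single c 1) = 0 := by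
    intro c hc hMc
    rw [← hMc, hu, form_mulVec M.2, form_single_right]
    rcases c with c | c <;> simp_all
  have hx : ∀ c : Fin n ⊕ Fin n, c ≠ Sum.inr j →
      form (Pi.single c 1) (Pi.single (Sum.inl j) 1) = 0 := by
    intro c hc
    rw [form_single_right]
    exact Pi.single_eq_of_ne hc.symm _
  have hz : ∀ c : Fin n ⊕ Fin n, c ≠ Sum.inl j →
      form (Pi.single c 1) (Pi.single (Sum.inr j) 1) = 0 := by
    intro c hc
    rw [form_single_right]
    exact Pi.single_eq_of_ne hc.symm _
  have hzx : form (Pi.single (Sum.inr j) 1 : Fin n ⊕ Fin n → ZMod 2)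
      (Pi.single (Sum.inl j) 1) = 1 := by
    rw [form_single_right]; simp
  have hu0 : u ≠ 0 := by
    intro h
    have h1 : form u (M.1 *ᵥ Pi.single (Sum.inr j) 1) = 1 := by
      rw [hu, form_mulVec M.2, form_comm, hzx]
    simp [h, form] at h1
  obtain ⟨b, hb⟩ := exists_form_single_eq_one hu0
  rcases eq_zero_or_eq_one (form u (Pi.single (Sum.inl j) 1)) with hf | hf
  -- When `u` is orthogonal to `x_j`, pass through an intermediate vector pairing to 1 with both:
  -- `z_j` if it pairs with `u`, otherwise `e_b + z_j`.
  · rcases eq_zero_or_eq_one (form u (Pi.single (Sum.inr j) 1)) with hf' | hf'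
    · have hbz : b ≠ Sum.inr j := by
        rintro rfl
        simp [hf'] at hb
      obtain ⟨g, hg, hgu, hga⟩ := exists_mem_gateGroup_of_form_eq_one₂
        (u := u) (w := Pi.single b 1 + Pi.single (Sum.inr j) 1) (v := Pi.single (Sum.inl j) 1)
        (by rw [form_add_right, hb, hf', add_zero])
        (by rw [form_add_left, hx b hbz, hzx, zero_add])
      refine ⟨g, hg, by rw [mul_apply, ← hu, hgu], fun c hc hc' hM hM' => ?_⟩
      rw [mul_apply, hM]
      have hcb : form (Pi.single c 1) (Pi.single b 1 + Pi.single (Sum.inr j) 1) = 0 := by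
        rw [form_add_right, hz c hc, add_zero, form_single_right, Pi.single_eq_of_ne]
        -- If `e_b` were the partner of `e_c`, it would be fixed by `M`, hence orthogonal to `u`.
        rintro rfl
        rw [Sum.swap_swap] at hM'
        rw [hfix b hbz hM'] at hb
        simp at hb
      refine hga _ ?_ ?_
      · rw [hcb, form_comm, hfix c hc' hM]
      · rw [hcb, hx c hc']
    · obtain ⟨g, hg, hgu, hga⟩ := exists_mem_gateGroup_of_form_eq_one₂ hf' hzx
      refine ⟨g, hg, by rw [mul_apply, ← hu, hgu], fun c hc hc' hM hM' => ?_⟩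
      rw [mul_apply, hM]
      refine hga _ ?_ ?_
      · rw [form_comm, hfix c hc' hM, hz c hc]
      · rw [hz c hc, hx c hc']
  · obtain ⟨g, hg, hgu, hga⟩ := exists_mem_gateGroup_of_form_eq_one hf
    refine ⟨g, hg, by rw [mul_apply, ← hu, hgu], fun c hc hc' hM hM' => ?_⟩
    rw [mul_apply, hM]
    refine hga _ ?_
    rw [form_comm, hfix c hc' hM, hx c hc']

/-- Since `x_j` is fixed, it pairs to 1 with both `M z_j` and `z_j`. Routing through `x_j + z_j`
when necessary uses only transvections along vectors orthogonal to `x_j`, which therefore stays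
fixed. -/
theorem exists_mem_gateGroup_fix_inr {n : ℕ} (M : Sp n) (j : Fin n)
    (hj : M.1 *ᵥ Pi.single (Sum.inl j) 1 = Pi.single (Sum.inl j) 1) :
    ∃ g ∈ gateGroup n, (g * M).1 *ᵥ Pi.single (Sum.inl j) 1 = Pi.single (Sum.inl j) 1 ∧
      (g * M).1 *ᵥ Pi.single (Sum.inr j) 1 = Pi.single (Sum.inr j) 1 ∧
      ∀ c : Fin n ⊕ Fin n, c ≠ Sum.inl j → c ≠ Sum.inr j →
        M.1 *ᵥ Pi.single c 1 = Pi.single c 1 →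
        (g * M).1 *ᵥ Pi.single c 1 = Pi.single c 1 := by
  obtain ⟨u, hu⟩ : ∃ u, u = M.1 *ᵥ Pi.single (Sum.inr j) 1 := ⟨_, rfl⟩
  have hfix : ∀ c : Fin n ⊕ Fin n, M.1 *ᵥ Pi.single c 1 = Pi.single c 1 →
      form (Pi.single c 1) u = form (Pi.single c 1) (Pi.single (Sum.inr j) 1) := by
    intro c hMc
    conv_lhs => rw [← hMc, hu, form_mulVec M.2]
  have hx : ∀ c : Fin n ⊕ Fin n, c ≠ Sum.inr j →
      form (Pi.single c 1) (Pi.single (Sum.inl j) 1) = 0 := by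
    intro c hc
    rw [form_single_right]
    exact Pi.single_eq_of_ne hc.symm _
  have hxz : form (Pi.single (Sum.inl j) 1 : Fin n ⊕ Fin n → ZMod 2)
      (Pi.single (Sum.inr j) 1) = 1 := by
    rw [form_single_right]; simp
  rcases eq_zero_or_eq_one (form u (Pi.single (Sum.inr j) 1)) with hf | hf
  · obtain ⟨g, hg, hgu, hga⟩ := exists_mem_gateGroup_of_form_eq_one₂
      (u := u) (w := Pi.single (Sum.inl j) 1 + Pi.single (Sum.inr j) 1)
      (v := Pi.single (Sum.inr j) 1)
      (by rw [form_add_right, hf, add_zero, form_comm, hfix _ hj, hxz])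
      (by rw [form_add_left, form_self, add_zero, hxz])
    refine ⟨g, hg, ?_, by rw [mul_apply, ← hu, hgu], fun c hc hc' hM => ?_⟩
    · rw [mul_apply, hj]
      refine hga _ ?_ ?_ <;> simp only [hfix _ hj, form_add_right, form_self, zero_add]
    · rw [mul_apply, hM]
      refine hga _ ?_ ?_ <;> simp only [hfix _ hM, form_add_right, hx c hc', zero_add]
  · obtain ⟨g, hg, hgu, hga⟩ := exists_mem_gateGroup_of_form_eq_one hf
    refine ⟨g, hg, ?_, by rw [mul_apply, ← hu, hgu], fun c hc hc' hM => ?_⟩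
    · rw [mul_apply, hj]
      exact hga _ (hfix _ hj)
    · rw [mul_apply, hM]
      exact hga _ (hfix _ hM)

/-- The gates generate the symplectic group. -/
theorem gateGroup_eq_top (n : ℕ) : gateGroup n = ⊤ := by
  rw [Subgroup.eq_top_iff']
  suffices H : ∀ s : Finset (Fin n), ∀ M : Sp n,
      (∀ c : Fin n ⊕ Fin n, Sum.elim id id c ∉ s → M.1 *ᵥ Pi.single c 1 = Pi.single c 1) →
      M ∈ gateGroup n from fun M => H Finset.univ M (by simp)
  intro s
  induction s using Finset.induction_on with
  | empty =>
    intro M hM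
    have : M = 1 := by
      refine Subtype.ext (Matrix.ext_of_mulVec_single fun c => ?_)
      rw [hM c (by simp), Submonoid.coe_one, one_mulVec]
    rw [this]
    exact one_mem _
  | insert j s hjs ih =>
    intro M hM
    obtain ⟨g, hg, hgx, hgc⟩ := exists_mem_gateGroup_fix_inl M j
    obtain ⟨k, hk, hkx, hkz, hkc⟩ := exists_mem_gateGroup_fix_inr (g * M) j hgx
    have hmem : k * (g * M) ∈ gateGroup n := by
      refine ih _ fun c hc => ?_
      by_cases hcx : c = Sum.inl j
      · rw [hcx, hkx]
      by_cases hcz : c = Sum.inr j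
      · rw [hcz, hkz]
      have hcj : Sum.elim id id c ∉ insert j s := by
        rw [Finset.mem_insert, not_or]
        refine ⟨?_, hc⟩
        rcases c with c | c <;> simp_all
      have hcj' : Sum.elim id id c.swap ∉ insert j s := by
        rcases c with c | c <;> simpa using hcj
      exact hkc c hcx hcz (hgc c hcx hcz (hM c hcj) (hM _ hcj'))
    exact (Subgroup.mul_mem_cancel_left _ hg).1 ((Subgroup.mul_mem_cancel_left _ hk).1 hmem)

/-! ### Convergence for doubly stochastic matrices -/

/-- Doeblin's argument: each block of `N` steps contracts the deviation from uniform by `1 - ε |α|`.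
-/
theorem abs_pow_sub_le {α : Type*} [Fintype α] [DecidableEq α] {P : Matrix α α ℝ}
    (hP : P ∈ doublyStochastic ℝ α) {N : ℕ} {ε : ℝ} (hε : ∀ i j, ε ≤ (P ^ N) i j) (j : α) (r k : ℕ) :
    ∀ i, |(P ^ (N * k + r)) i j - 1 / (Fintype.card α : ℝ)| ≤ (1 - ε * Fintype.card α) ^ k := by
  have hS : ∀ d, P ^ d ∈ doublyStochastic ℝ α := fun d => pow_mem hP d
  induction k with
  | zero =>
    intro i
    have hc : (1 : ℝ) ≤ Fintype.card α := by
      exact_mod_cast Fintype.card_pos_iff.2 ⟨i⟩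
    have h1 : 1 / (Fintype.card α : ℝ) ≤ 1 := by
      rw [div_le_one (by linarith)]
      exact hc
    have h0 : 0 ≤ 1 / (Fintype.card α : ℝ) := by positivity
    have h2 := nonneg_of_mem_doublyStochastic (hS (N * 0 + r)) (i := i) (j := j)
    have h3 := le_one_of_mem_doublyStochastic (hS (N * 0 + r)) (i := i) (j := j)
    rw [pow_zero, abs_le]
    constructor <;> linarith
  | succ k ih =>
    intro i
    have hc : (Fintype.card α : ℝ) ≠ 0 := by
      exact_mod_cast (Fintype.card_pos_iff.2 ⟨i⟩).ne'
    have hrow := sum_row_of_mem_doublyStochastic (hS N) i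
    have hcol := sum_col_of_mem_doublyStochastic (hS (N * k + r)) j
    -- Deviations in a column sum to zero, so subtracting `ε` from `P ^ N` is free and leaves
    -- nonnegative rows of sum `1 - ε |α|`.
    have key : (P ^ (N * (k + 1) + r)) i j - 1 / (Fintype.card α : ℝ) =
        ∑ l, ((P ^ N) i l - ε) * ((P ^ (N * k + r)) l j - 1 / (Fintype.card α : ℝ)) := by
      rw [show N * (k + 1) + r = N + (N * k + r) by ring, pow_add, Matrix.mul_apply]
      simp only [sub_mul, mul_sub, Finset.sum_sub_distrib, ← Finset.mul_sum, ← Finset.sum_mul,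
        hrow, hcol, Finset.sum_const, Finset.card_univ, nsmul_eq_mul]
      field_simp
      ring
    rw [key]
    refine (Finset.abs_sum_le_sum_abs _ _).trans ?_
    calc ∑ l, |((P ^ N) i l - ε) * ((P ^ (N * k + r)) l j - 1 / (Fintype.card α : ℝ))|
        ≤ ∑ l, ((P ^ N) i l - ε) * (1 - ε * Fintype.card α) ^ k := by
          refine Finset.sum_le_sum fun l _ => ?_
          rw [abs_mul, abs_of_nonneg (sub_nonneg.2 (hε i l))]
          exact mul_le_mul_of_nonneg_left (ih l) (sub_nonneg.2 (hε i l))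
      _ = (1 - ε * Fintype.card α) ^ (k + 1) := by
          rw [← Finset.sum_mul, Finset.sum_sub_distrib, hrow, Finset.sum_const, Finset.card_univ,
            nsmul_eq_mul, pow_succ']
          ring

/-- The powers of a doubly stochastic matrix with a positive power converge to the uniform
matrix. -/
theorem tendsto_pow_of_doublyStochastic {α : Type*} [Fintype α] [DecidableEq α] {P : Matrix α α ℝ}
    (hP : P ∈ doublyStochastic ℝ α) {N : ℕ} (hN : 0 < N) (hpos : ∀ i j, 0 < (P ^ N) i j)
    (i j : α) :
    Tendsto (fun d : ℕ => (P ^ d) i j) atTop (𝓝 (1 / (Fintype.card α : ℝ))) := by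
  have : Nonempty (α × α) := ⟨(i, j)⟩
  obtain ⟨p, hp⟩ := Finite.exists_min fun p : α × α => (P ^ N) p.1 p.2
  have hε : ∀ i j, (P ^ N) p.1 p.2 ≤ (P ^ N) i j := fun i j => hp (i, j)
  have hε0 := hpos p.1 p.2
  generalize (P ^ N) p.1 p.2 = ε at hε hε0
  have hc : (0 : ℝ) < Fintype.card α := by
    exact_mod_cast Fintype.card_pos_iff.2 ⟨i⟩
  have h0 : 0 ≤ 1 - ε * Fintype.card α := by
    have hrow := sum_row_of_mem_doublyStochastic (pow_mem hP N) i
    have := Finset.sum_le_sum fun l (_ : l ∈ Finset.univ) => hε i l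
    rw [hrow, Finset.sum_const, Finset.card_univ, nsmul_eq_mul] at this
    linarith
  have h1 : 1 - ε * Fintype.card α < 1 := by
    have := mul_pos hε0 hc
    linarith
  rw [tendsto_iff_dist_tendsto_zero]
  refine squeeze_zero (fun _ => dist_nonneg) (fun d => ?_)
    ((tendsto_pow_atTop_nhds_zero_of_lt_one h0 h1).comp (Nat.tendsto_div_const_atTop hN.ne'))
  have := abs_pow_sub_le hP hε j (d % N) (d / N) i
  rwa [Nat.div_add_mod] at this

/-! ### Transition matrix and words in the gates -/

theorem transition_apply {n : ℕ} (M N : Sp n) : transition n M N =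
    (((generators n).filter (fun G => M * G = N)).card : ℝ) / ((generators n).card : ℝ) := rfl

theorem transition_pos {n : ℕ} (M : Sp n) {G : Sp n} (hG : G ∈ generators n) :
    0 < transition n M (M * G) := by
  rw [transition_apply]
  refine div_pos ?_ ?_ <;> rw [Nat.cast_pos, Finset.card_pos]
  · exact ⟨G, by simp [hG]⟩
  · exact ⟨G, hG⟩

theorem transition_mem_doublyStochastic {n : ℕ} (hn : 0 < n) :
    transition n ∈ doublyStochastic ℝ (Sp n) := by
  have hc : ((generators n).card : ℝ) ≠ 0 :=
    Nat.cast_ne_zero.2 (Finset.card_ne_zero_of_mem (gateH_mem ⟨0, hn⟩))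
  rw [mem_doublyStochastic_iff_sum]
  refine ⟨fun M N => by rw [transition_apply]; positivity, fun M => ?_, fun N => ?_⟩
  · simp only [transition_apply]
    rw [← Finset.sum_div, ← Nat.cast_sum, ← Finset.card_eq_sum_card_fiberwise (fun _ _ => by simp),
      div_self hc]
  · have h : ∀ M G : Sp n, M * G = N ↔ N * G⁻¹ = M := fun M G => by
      rw [mul_inv_eq_iff_eq_mul, eq_comm]
    simp only [transition_apply, h]
    rw [← Finset.sum_div, ← Nat.cast_sum, ← Finset.card_eq_sum_card_fiberwise (fun _ _ => by simp),
      div_self hc]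

theorem transition_pow_pos {n : ℕ} (hn : 0 < n) (l : List (Sp n)) (hl : ∀ g ∈ l, g ∈ generators n)
    (M : Sp n) : 0 < (transition n ^ l.length) M (M * l.prod) := by
  have hS := transition_mem_doublyStochastic hn
  induction l generalizing M with
  | nil => simp
  | cons g l ih =>
    rw [List.length_cons, pow_succ', Matrix.mul_apply, List.prod_cons, ← mul_assoc]
    refine Finset.sum_pos' (fun N _ => mul_nonneg (nonneg_of_mem_doublyStochastic hS)
      (nonneg_of_mem_doublyStochastic (pow_mem hS _))) ⟨M * g, Finset.mem_univ _, ?_⟩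
    exact mul_pos (transition_pos M (hl g (by simp))) (ih (fun k hk => hl k (by simp [hk])) _)

/-! ### Involutions and a relation of odd length -/

theorem gateH_mul_self {n : ℕ} (i : Fin n) : gateH i * gateH i = 1 := by
  rw [gateH_eq, transvection_mul_self]

theorem gateS_mul_self {n : ℕ} (i : Fin n) : gateS i * gateS i = 1 := by
  rw [gateS_eq, transvection_mul_self]

theorem gateCZ_mul_self {n : ℕ} {i j : Fin n} : gateCZ i j * gateCZ i j = 1 := by
  refine Sp_ext fun w => ?_
  simp only [mul_apply, gateCZ_apply]
  ext a
  have key : ∀ x y z : ZMod 2, x + y + z + y + z = x := by decide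
  simpa [Pi.single_apply] using key _ _ _

theorem mul_self_of_mem_generators {n : ℕ} {g : Sp n} (hg : g ∈ generators n) : g * g = 1 := by
  simp only [generators, Finset.mem_union, Finset.mem_image, Finset.mem_filter] at hg
  rcases hg with (⟨i, -, rfl⟩ | ⟨i, -, rfl⟩) | ⟨p, -, rfl⟩
  · exact gateH_mul_self i
  · exact gateS_mul_self i
  · exact gateCZ_mul_self

/-- Conjugating `CZ` by a Hadamard gate on its second qubit gives the controlled-`NOT` gate. -/
theorem cnot_apply {n : ℕ} {k l : Fin n} (h : k ≠ l) (w : Fin n ⊕ Fin n → ZMod 2) :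
    (gateH l * gateCZ k l * gateH l).1 *ᵥ w =
      w + Pi.single (Sum.inr l) (w (Sum.inr k)) + Pi.single (Sum.inl k) (w (Sum.inl l)) := by
  simp only [mul_apply, gateH_apply, gateCZ_apply]
  ext a
  rcases a with a | a
  · by_cases h1 : a = l
    · subst h1
      simp [h, h.symm, Equiv.swap_apply_def]
    · simp [h, h1, Equiv.swap_apply_def]
  · by_cases h1 : a = l
    · subst h1
      simp [h, h.symm, Equiv.swap_apply_def]
    · simp [h, h1, Equiv.swap_apply_def]

/-- CNOT gates act like elementary matrices, and `[E_ab, E_bc] = E_ac` over `𝔽₂`, all factors being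
involutions. -/
theorem cnot_commutator {n : ℕ} {a b c : Fin n} (hab : a ≠ b) (hbc : b ≠ c) (hac : a ≠ c) :
    (gateH b * gateCZ a b * gateH b) * (gateH c * gateCZ b c * gateH c) *
      (gateH b * gateCZ a b * gateH b) * (gateH c * gateCZ b c * gateH c) *
      (gateH c * gateCZ a c * gateH c) = 1 := by
  refine Sp_ext fun w => ?_
  rw [mul_apply, mul_apply, mul_apply, mul_apply, cnot_apply hab, cnot_apply hbc, cnot_apply hab,
    cnot_apply hbc, cnot_apply hac]
  have h1 : ∀ x y z : ZMod 2, x + z + (y + z) + (y + z + z) = x := by decide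
  have h2 : ∀ x y z : ZMod 2, x + y + z + (z + y) = x := by decide
  have h3 : ∀ x y : ZMod 2, x + y + y = x := by decide
  ext i
  rcases i with i | i
  · by_cases hi : i = a
    · subst hi
      simpa [hab, hbc, hac, hab.symm, hbc.symm, hac.symm] using h1 _ _ _
    · by_cases hj : i = b
      · subst hj
        simpa [hab, hbc, hac, hab.symm, hbc.symm, hac.symm] using h3 _ _
      · simp [hi, hj]
  · by_cases hi : i = c
    · subst hi
      simpa [hab, hbc, hac, hab.symm, hbc.symm, hac.symm] using h2 _ _ _
    · by_cases hj : i = b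
      · subst hj
        simpa [hab, hbc, hac, hab.symm, hbc.symm, hac.symm] using h3 _ _
      · simp [hi, hj]

theorem exists_list_of_generators {n : ℕ} (M : Sp n) :
    ∃ l : List (Sp n), (∀ g ∈ l, g ∈ generators n) ∧ l.prod = M := by
  have hM : M ∈ (Subgroup.closure (generators n : Set (Sp n))).toSubmonoid := by
    change M ∈ gateGroup n
    rw [gateGroup_eq_top]
    trivial
  rw [Subgroup.closure_toSubmonoid] at hM
  obtain ⟨l, hl, hp⟩ := Submonoid.exists_list_of_mem_closure hM
  refine ⟨l, fun g hg => ?_, hp⟩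
  rcases hl g hg with h | h
  · exact h
  · have := mul_self_of_mem_generators (Finset.mem_coe.1 (Set.mem_inv.1 h))
    rwa [Set.mem_inv, inv_eq_of_mul_eq_one_left (inv_injective (by simpa using this))] at h

theorem exists_list_of_length {n : ℕ} (hn : 3 ≤ n) (M : Sp n) :
    ∃ L, ∀ d, L ≤ d → ∃ l : List (Sp n), (∀ g ∈ l, g ∈ generators n) ∧ l.prod = M ∧
      l.length = d := by
  obtain ⟨l, hl, hp⟩ := exists_list_of_generators M
  obtain ⟨a, b, c, hab, hbc, hac⟩ : ∃ a b c : Fin n, a ≠ b ∧ b ≠ c ∧ a ≠ c :=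
    ⟨⟨0, by omega⟩, ⟨1, by omega⟩, ⟨2, by omega⟩, by simp, by simp, by simp⟩
  obtain ⟨r, hr, hr1, hrl⟩ : ∃ r : List (Sp n), (∀ g ∈ r, g ∈ generators n) ∧ r.prod = 1 ∧
      r.length = 15 := by
    -- Five CNOT gates of three gates each: an odd-length word for 1.
    refine ⟨[gateH b, gateCZ a b, gateH b, gateH c, gateCZ b c, gateH c, gateH b, gateCZ a b,
      gateH b, gateH c, gateCZ b c, gateH c, gateH c, gateCZ a c, gateH c], ?_, ?_, rfl⟩
    · simp [gateH_mem, gateCZ_mem, hab, hbc, hac]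
    · rw [← cnot_commutator hab hbc hac]
      simp [mul_assoc]
  have hpad : ∀ k, (List.replicate (2 * k) (gateH a)).prod = 1 := fun k => by
    rw [List.prod_replicate, pow_mul, pow_two, gateH_mul_self, one_pow]
  refine ⟨l.length + 15, fun d hd => ?_⟩
  rcases Nat.even_or_odd' (d - l.length) with ⟨k, hk | hk⟩
  · refine ⟨l ++ List.replicate (2 * k) (gateH a), ?_, ?_, ?_⟩
    · intro g hg
      rcases List.mem_append.1 hg with h | h
      · exact hl g h
      · rw [List.eq_of_mem_replicate h]
        exact gateH_mem a
    · rw [List.prod_append, hp, hpad, mul_one]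
    · rw [List.length_append, List.length_replicate]
      omega
  -- Here `2k + 1 = 15 + 2(k - 7)`, and the threshold `l.length + 15` ensures `k ≥ 7`.
  · refine ⟨l ++ (r ++ List.replicate (2 * (k - 7)) (gateH a)), ?_, ?_, ?_⟩
    · intro g hg
      rcases List.mem_append.1 hg with h | h
      · exact hl g h
      rcases List.mem_append.1 h with h | h
      · exact hr g h
      · rw [List.eq_of_mem_replicate h]
        exact gateH_mem a
    · rw [List.prod_append, List.prod_append, hp, hpad, hr1, mul_one, mul_one]
    · rw [List.length_append, List.length_append, List.length_replicate, hrl]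
      omega

theorem exists_transition_pow_pos {n : ℕ} (hn : 3 ≤ n) :
    ∃ N, 0 < N ∧ ∀ A B, 0 < (transition n ^ N) A B := by
  choose L hL using fun M : Sp n => exists_list_of_length hn M
  refine ⟨Finset.univ.sup L + 1, Nat.succ_pos _, fun A B => ?_⟩
  obtain ⟨l, hl, hp, hlen⟩ := hL (A⁻¹ * B) (Finset.univ.sup L + 1)
    ((Finset.le_sup (Finset.mem_univ _)).trans (Nat.le_succ _))
  have := transition_pow_pos (by omega) l hl A
  rwa [hp, mul_inv_cancel_left, hlen] at this

theorem tendsto_transition_pow {n : ℕ} (hn : 3 ≤ n) (M : Sp n) :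
    Tendsto (fun d : ℕ => (transition n ^ d) 1 M) atTop
      (𝓝 (1 / (Fintype.card (Sp n) : ℝ))) := by
  obtain ⟨N, hN, hpos⟩ := exists_transition_pow_pos hn
  exact tendsto_pow_of_doublyStochastic (transition_mem_doublyStochastic (by omega)) hN hpos 1 M

/-! ### Quadratic forms and the sign character -/

/-- The quadratic form with polarization `form` and values `q` on the standard basis. -/
def quad {n : ℕ} (q v : Fin n ⊕ Fin n → ZMod 2) : ZMod 2 :=
  q ⬝ᵥ v + ∑ k, v (Sum.inl k) * v (Sum.inr k)

theorem quad_add {n : ℕ} (q v w : Fin n ⊕ Fin n → ZMod 2) :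
    quad q (v + w) = quad q v + quad q w + form v w := by
  have h : ∑ k, (v + w) (Sum.inl k) * (v + w) (Sum.inr k) = ∑ k, v (Sum.inl k) * v (Sum.inr k) +
      ∑ k, w (Sum.inl k) * w (Sum.inr k) + form v w := by
    rw [form_eq_sum, ← Finset.sum_add_distrib, ← Finset.sum_add_distrib]
    exact Finset.sum_congr rfl fun k _ => by simp only [Pi.add_apply]; ring
  rw [quad, quad, quad, dotProduct_add, h]
  ring

theorem quad_single {n : ℕ} (q : Fin n ⊕ Fin n → ZMod 2) (a : Fin n ⊕ Fin n) :
    quad q (Pi.single a 1) = q a := by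
  rcases a with a | a <;> simp [quad]

/-- The pullback of quadratic forms along a symplectic matrix, in coordinates. -/
def pull {n : ℕ} (M : Sp n) (q : Fin n ⊕ Fin n → ZMod 2) : Fin n ⊕ Fin n → ZMod 2 :=
  fun a => quad q (M.1 *ᵥ Pi.single a 1)

theorem quad_pull {n : ℕ} (M : Sp n) (q v : Fin n ⊕ Fin n → ZMod 2) :
    quad (pull M q) v = quad q (M.1 *ᵥ v) := by
  -- Both forms have the same polarization, so their difference is additive and can be checked on
  -- the basis.
  let D : (Fin n ⊕ Fin n → ZMod 2) →+ ZMod 2 := AddMonoidHom.mk'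
    (fun v => quad (pull M q) v - quad q (M.1 *ᵥ v)) fun v w => by
      simp only [mulVec_add, quad_add, form_mulVec M.2]
      ring
  have hD : D = 0 := by
    refine AddMonoidHom.functions_ext _ _ _ fun a x => ?_
    have : D (Pi.single a 1) = 0 := by
      change quad (pull M q) _ - _ = 0
      rw [quad_single, pull, sub_self]
    rcases eq_zero_or_eq_one x with rfl | rfl
    · rw [Pi.single_zero, map_zero, map_zero]
    · rw [this, AddMonoidHom.zero_apply]
  exact sub_eq_zero.1 (DFunLike.congr_fun hD v)

theorem pull_mul {n : ℕ} (M N : Sp n) (q : Fin n ⊕ Fin n → ZMod 2) :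
    pull (M * N) q = pull N (pull M q) := by
  funext a
  rw [pull, pull, quad_pull, mul_apply]

theorem pull_one {n : ℕ} (q : Fin n ⊕ Fin n → ZMod 2) : pull 1 q = q := by
  funext a
  rw [pull, Submonoid.coe_one, one_mulVec, quad_single]

/-- A quadratic form is even if it vanishes on more than half of the vectors. -/
abbrev IsEven {n : ℕ} (q : Fin n ⊕ Fin n → ZMod 2) : Prop :=
  2 ^ (2 * n) < 2 * (Finset.univ.filter fun v => quad q v = 0).card

theorem IsEven.pull {n : ℕ} (M : Sp n) {q : Fin n ⊕ Fin n → ZMod 2} (hq : IsEven q) :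
    IsEven (pull M q) := by
  have h : (Finset.univ.filter fun v => quad q v = 0).card =
      (Finset.univ.filter fun v => quad (CliffordWalk.pull M q) v = 0).card := by
    have hM : ∀ v, M.1 *ᵥ ((M⁻¹).1 *ᵥ v) = v := fun v => by
      rw [← mul_apply, mul_inv_cancel, Submonoid.coe_one, one_mulVec]
    have hM' : ∀ v, (M⁻¹).1 *ᵥ (M.1 *ᵥ v) = v := fun v => by
      rw [← mul_apply, inv_mul_cancel, Submonoid.coe_one, one_mulVec]
    refine Finset.card_bij' (fun v _ => (M⁻¹).1 *ᵥ v) (fun v _ => M.1 *ᵥ v) ?_ ?_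
      (fun v _ => hM v) (fun v _ => hM' v) <;>
    · intro v hv
      rw [Finset.mem_filter_univ] at hv ⊢
      rw [← hv, quad_pull]
      try rw [hM]
  rwa [IsEven, ← h]

/-- The action of a symplectic matrix on the even quadratic forms. -/
def evenPerm {n : ℕ} (M : Sp n) : Equiv.Perm {q : Fin n ⊕ Fin n → ZMod 2 // IsEven q} where
  toFun q := ⟨pull M q.1, q.2.pull M⟩
  invFun q := ⟨pull M⁻¹ q.1, q.2.pull M⁻¹⟩
  left_inv q := Subtype.ext ((pull_mul M M⁻¹ q.1).symm.trans (by rw [mul_inv_cancel, pull_one]))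
  right_inv q := Subtype.ext ((pull_mul M⁻¹ M q.1).symm.trans (by rw [inv_mul_cancel, pull_one]))

/-- The sign of the action on the even quadratic forms. -/
def evenSign {n : ℕ} (M : Sp n) : ℤˣ := Equiv.Perm.sign (evenPerm M)

/-- Pullback reverses products, which is harmless in the commutative group `ℤˣ`. -/
theorem evenSign_mul {n : ℕ} (M N : Sp n) : evenSign (M * N) = evenSign M * evenSign N := by
  have h : evenPerm (M * N) = evenPerm N * evenPerm M :=
    Equiv.ext fun q => Subtype.ext (pull_mul M N q.1)
  rw [evenSign, h, Equiv.Perm.sign_mul, mul_comm]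
  rfl

/-- A finite check: there are 3 even forms for `n = 1` and 10 for `n = 2`. -/
theorem evenSign_gateH {n : ℕ} (hn : n = 1 ∨ n = 2) : ∀ i : Fin n, evenSign (gateH i) = -1 := by
  rcases hn with rfl | rfl <;> decide +kernel

theorem evenSign_gateS {n : ℕ} (hn : n = 1 ∨ n = 2) : ∀ i : Fin n, evenSign (gateS i) = -1 := by
  rcases hn with rfl | rfl <;> decide +kernel

theorem evenSign_gateCZ {n : ℕ} (hn : n = 1 ∨ n = 2) :
    ∀ i j : Fin n, i < j → evenSign (gateCZ i j) = -1 := by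
  rcases hn with rfl | rfl <;> decide +kernel

theorem evenSign_of_mem_generators {n : ℕ} (hn : n = 1 ∨ n = 2) {g : Sp n}
    (hg : g ∈ generators n) : evenSign g = -1 := by
  simp only [generators, Finset.mem_union, Finset.mem_image, Finset.mem_filter] at hg
  rcases hg with (⟨i, -, rfl⟩ | ⟨i, -, rfl⟩) | ⟨p, ⟨-, hp⟩, rfl⟩
  · exact evenSign_gateH hn i
  · exact evenSign_gateS hn i
  · exact evenSign_gateCZ hn _ _ hp

theorem evenSign_of_transition_pow_ne_zero {n : ℕ} (hn : n = 1 ∨ n = 2) (d : ℕ) {M N : Sp n}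
    (h : (transition n ^ d) M N ≠ 0) : evenSign N = evenSign M * (-1) ^ d := by
  induction d generalizing N with
  | zero =>
    rw [pow_zero, Matrix.one_apply] at h
    rw [pow_zero, mul_one]
    by_contra hne
    exact h (if_neg fun hMN => hne (by rw [hMN]))
  | succ d ih =>
    rw [pow_succ, Matrix.mul_apply] at h
    obtain ⟨L, -, hL⟩ := Finset.exists_ne_zero_of_sum_ne_zero h
    have h1 := ih (left_ne_zero_of_mul hL)
    have h2 := right_ne_zero_of_mul hL
    rw [transition_apply] at h2
    obtain ⟨G, hG⟩ : ((generators n).filter (fun G => L * G = N)).Nonempty := by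
      rw [← Finset.card_ne_zero]
      exact fun h0 => h2 (by rw [h0, Nat.cast_zero, zero_div])
    rw [Finset.mem_filter] at hG
    rw [← hG.2, evenSign_mul, h1, evenSign_of_mem_generators hn hG.1, pow_succ, mul_assoc]

/-! ### Periodicity and failure of convergence for `n = 1, 2` -/

theorem even_of_transition_pow_pos {n : ℕ} (hn : n = 1 ∨ n = 2) {d : ℕ} {M : Sp n}
    (h : 0 < (transition n ^ d) M M) : Even d := by
  have h1 := evenSign_of_transition_pow_ne_zero hn d h.ne'
  rw [left_eq_mul] at h1
  by_contra hd
  rw [(Nat.not_even_iff_odd.1 hd).neg_one_pow] at h1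
  exact absurd h1 (by decide)

theorem hasPeriod_two {n : ℕ} (hn : n = 1 ∨ n = 2) (M : Sp n) : HasPeriod (transition n) M 2 := by
  have hn0 : 0 < n := by omega
  refine fun m => ⟨fun hm k _ hk => hm.trans (even_of_transition_pow_pos hn hk).two_dvd,
    fun h => h 2 (by norm_num) ?_⟩
  have := transition_pow_pos hn0 [gateH ⟨0, hn0⟩, gateH ⟨0, hn0⟩] (by simp [gateH_mem]) M
  simpa [gateH_mul_self] using this

theorem not_exists_limit {n : ℕ} (hn : n = 1 ∨ n = 2) :
    ¬ ∃ μ : Sp n → ℝ, ∀ M : Sp n,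
      Tendsto (fun d : ℕ => (transition n ^ d) 1 M) atTop (𝓝 (μ M)) := by
  rintro ⟨μ, hμ⟩
  -- A nonzero limit would make the entry nonzero at two consecutive times, against the alternating
  -- sign. All limits thus vanish, although each row sums to 1.
  have h0 : ∀ M, μ M = 0 := by
    intro M
    by_contra hM
    obtain ⟨N, hN⟩ := eventually_atTop.1 ((hμ M).eventually_ne hM)
    have h1 := evenSign_of_transition_pow_ne_zero hn _ (hN N le_rfl)
    have h2 := evenSign_of_transition_pow_ne_zero hn _ (hN (N + 1) N.le_succ)
    rw [h1, mul_right_inj, pow_succ, left_eq_mul] at h2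
    exact absurd h2 (by decide)
  have hsum := tendsto_finsetSum Finset.univ fun M _ => hμ M
  simp only [h0, Finset.sum_const_zero, sum_row_of_mem_doublyStochastic
    (pow_mem (transition_mem_doublyStochastic (by omega : 0 < n)) _)] at hsum
  exact one_ne_zero (tendsto_nhds_unique tendsto_const_nhds hsum)

end CliffordWalk

theorem mainTheorem1 :
    (∀ n : ℕ, 3 ≤ n → ∀ M : CliffordWalk.Sp n,
      Tendsto (fun d : ℕ => (CliffordWalk.transition n ^ d) 1 M) atTop
        (𝓝 (1 / (Fintype.card (CliffordWalk.Sp n) : ℝ)))) ∧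
    (∀ n : ℕ, n = 1 ∨ n = 2 →
      (∀ M : CliffordWalk.Sp n, CliffordWalk.HasPeriod (CliffordWalk.transition n) M 2) ∧
      (¬ ∀ M : CliffordWalk.Sp n,
        Tendsto (fun d : ℕ => (CliffordWalk.transition n ^ d) 1 M) atTop
          (𝓝 (1 / (Fintype.card (CliffordWalk.Sp n) : ℝ)))) ∧
      (¬ ∃ μ : CliffordWalk.Sp n → ℝ, ∀ M : CliffordWalk.Sp n,
        Tendsto (fun d : ℕ => (CliffordWalk.transition n ^ d) 1 M) atTop (𝓝 (μ M)))) :=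
  ⟨fun _ hn M => CliffordWalk.tendsto_transition_pow hn M, fun _ hn =>
    ⟨CliffordWalk.hasPeriod_two hn,
      fun h => CliffordWalk.not_exists_limit hn ⟨_, h⟩, CliffordWalk.not_exists_limit hn⟩⟩
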